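/- Let $N,K\ge 0$ be integers. For $Z\in\mathbb{R}^{N\times K}$ with rows $z_1,\dots,z_N$ put $\|Z\|_{2,1}=\sum_{n=1}^N\|z_n\|_2$. For a symmetric positive semidefinite matrix $M$ let $M^{\dagger}$ be its Moore–Penrose pseudo-inverse and let $M^{\dagger/2}=(M^{\dagger})^{1/2}$ be the positive semidefinite square root of $M^\dagger$. For $\gamma\in[0,1]$ define \[ \Psi_\gamma(Z)=\bigl\|Z\,(\gamma I+(1-\gamma)Z^TZ)^{\dagger/2}\bigr\|_{2,1}, \qquad \mathit{ow}\ell_{2,1}(Z)=\bigl\|Z\,(Z^TZ)^{\dagger/2}\bigr\|_{2,1}. \] Then $\Psi_\gamma$ $\Gamma$-converges to $\mathit{ow}\ell_{2,1}$ on $\mathbb{R}^{N\times K}$ as $\gamma\to0$. That is, for every sequence $(\gamma_k)$ in $[0,1]$ with $\gamma_k\to0$ and every $Z\in\mathbb{R}^{N\times K}$: 1. for every sequence $Z_k\to Z$ in $\mathbb{R}^{N\times K}$, \[ \liminf_{k\to\infty}\Psi_{\gamma_k}(Z_k)\ \ge\ \mathit{ow}\ell_{2,1}(Z); \] 2. there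 is a sequence $Z_k\to Z$ with \[ \limsup_{k\to\infty}\Psi_{\gamma_k}(Z_k)\ \le\ \mathit{ow}\ell_{2,1}(Z). \] In (2) the constant sequence $Z_k=Z$ can be taken, and for it $\Psi_{\gamma_k}(Z)\to\mathit{ow}\ell_{2,1}(Z)$. Moreover, $\mathit{ow}\ell_{2,1}$ is lower semicontinuous on $\mathbb{R}^{N\times K}$. -/

import Mathlib

open Filter Topology Set
open scoped Matrix MatrixOrder

noncomputable section

/-- The four Penrose equations: `X` is a Moore–Penrose pseudo-inverse of the real matrix `M`. -/
structure IsMoorePenrose {m n : Type*} [Fintype m] [Fintype n]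
    (M : Matrix m n ℝ) (X : Matrix n m ℝ) : Prop where
  mul_mul_left : M * X * M = M
  mul_mul_right : X * M * X = X
  symm_left : (M * X)ᵀ = M * X
  symm_right : (X * M)ᵀ = X * M

theorem IsMoorePenrose.unique {m n : Type*} [Fintype m] [Fintype n]
    {M : Matrix m n ℝ} {X Y : Matrix n m ℝ}
    (hX : IsMoorePenrose M X) (hY : IsMoorePenrose M Y) : X = Y := by
  have h1 : M * X = M * Y := by
    calc M * X = (M * Y) * (M * X) := by
          rw [← Matrix.mul_assoc, hY.mul_mul_left]
      _ = ((M * X) * (M * Y))ᵀ := by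
          rw [Matrix.transpose_mul (M * X), hX.symm_left, hY.symm_left]
      _ = (M * Y)ᵀ := by rw [← Matrix.mul_assoc, hX.mul_mul_left]
      _ = M * Y := hY.symm_left
  have h2 : X * M = Y * M := by
    calc X * M = (X * M) * (Y * M) := by
          rw [Matrix.mul_assoc X M, ← Matrix.mul_assoc M Y M, hY.mul_mul_left]
      _ = ((Y * M) * (X * M))ᵀ := by
          rw [Matrix.transpose_mul (Y * M), hX.symm_right, hY.symm_right]
      _ = (Y * M)ᵀ := by
          rw [Matrix.mul_assoc Y M, ← Matrix.mul_assoc M X M, hX.mul_mul_left]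
      _ = Y * M := hY.symm_right
  calc X = X * M * X := hX.mul_mul_right.symm
    _ = Y * M * X := by rw [h2]
    _ = Y * M * Y := by rw [Matrix.mul_assoc, h1, ← Matrix.mul_assoc]
    _ = Y := hY.mul_mul_right

/-- For a symmetric matrix the pseudo-inverse inverts the nonzero eigenvalues. -/
theorem isMoorePenrose_cfc_inv {n : Type*} [Fintype n] [DecidableEq n]
    {A : Matrix n n ℝ} (hA : IsSelfAdjoint A) :
    IsMoorePenrose A (cfc (fun x : ℝ => x⁻¹) A) := by
  have hc : ∀ f : ℝ → ℝ, ContinuousOn f (spectrum ℝ A) :=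
    fun f => Matrix.finite_real_spectrum.continuousOn f
  have hid : cfc (fun x : ℝ => x) A = A := cfc_id' ℝ A
  have hl : A * cfc (fun x : ℝ => x⁻¹) A = cfc (fun x : ℝ => x * x⁻¹) A := by
    rw [cfc_mul _ _ A (hc _) (hc _), hid]
  have hr : cfc (fun x : ℝ => x⁻¹) A * A = cfc (fun x : ℝ => x * x⁻¹) A := by
    rw [← hl]
    have h := cfc_commute_cfc (fun x : ℝ => x⁻¹) (fun x => x) A
    rw [hid] at h
    exact h.eq
  have hs : (cfc (fun x : ℝ => x * x⁻¹) A)ᵀ = cfc (fun x : ℝ => x * x⁻¹) A := by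
    have h : IsSelfAdjoint (cfc (fun x : ℝ => x * x⁻¹) A) := cfc_predicate _ A
    rw [← Matrix.conjTranspose_eq_transpose_of_trivial]
    exact h
  refine ⟨?_, ?_, by rw [hl, hs], by rw [hr, hs]⟩
  · rw [hl]
    calc _ = cfc (fun x : ℝ => x * x⁻¹) A * cfc (fun x : ℝ => x) A := by rw [hid]
      _ = cfc (fun x : ℝ => x) A := by
        rw [← cfc_mul _ _ A (hc _) (hc _)]
        simp
      _ = A := hid
  · rw [hr, ← cfc_mul _ _ A (hc _) (hc _)]
    congr 1
    ext x
    by_cases hx : x = 0 <;> simp [hx]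

theorem exists_isMoorePenrose {m n : Type*} [Fintype m] [Fintype n]
    (M : Matrix m n ℝ) : ∃ X, IsMoorePenrose M X := by
  classical
  have hG : IsSelfAdjoint (Mᵀ * M) := by
    rw [isSelfAdjoint_iff, Matrix.star_eq_conjTranspose,
      Matrix.conjTranspose_eq_transpose_of_trivial, Matrix.transpose_mul,
      Matrix.transpose_transpose]
  obtain ⟨P, hP, hPs⟩ : ∃ P, IsMoorePenrose (Mᵀ * M) P ∧ Pᵀ = P := by
    refine ⟨_, isMoorePenrose_cfc_inv hG, ?_⟩
    rw [← Matrix.conjTranspose_eq_transpose_of_trivial]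
    exact cfc_predicate (fun x : ℝ => x⁻¹) (Mᵀ * M)
  have hD : M * (P * (Mᵀ * M)) = M := by
    have h0 : (M - M * (P * (Mᵀ * M)))ᵀ * (M - M * (P * (Mᵀ * M))) = 0 := by
      have h1 : Mᵀ * (M - M * (P * (Mᵀ * M))) = 0 := by
        rw [Matrix.mul_sub, sub_eq_zero]
        have := hP.mul_mul_left
        simp only [Matrix.mul_assoc] at this ⊢
        exact this.symm
      rw [Matrix.transpose_sub, Matrix.transpose_mul M, Matrix.sub_mul, Matrix.mul_assoc, h1]
      simp
    rw [← Matrix.conjTranspose_eq_transpose_of_trivial,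
      Matrix.conjTranspose_mul_self_eq_zero, sub_eq_zero] at h0
    exact h0.symm
  refine ⟨P * Mᵀ, ?_, ?_, ?_, ?_⟩
  · simpa only [Matrix.mul_assoc] using hD
  · have := congrArg (· * Mᵀ) hP.mul_mul_right
    simpa only [Matrix.mul_assoc] using this
  · simp only [Matrix.transpose_mul, Matrix.transpose_transpose, hPs, Matrix.mul_assoc]
  · simpa only [Matrix.mul_assoc] using hP.symm_right

/-- The Moore–Penrose pseudo-inverse `M†`. -/
def pinv {m n : Type*} [Fintype m] [Fintype n] (M : Matrix m n ℝ) : Matrix n m ℝ :=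
  (exists_isMoorePenrose M).choose

theorem pinv_spec {m n : Type*} [Fintype m] [Fintype n] (M : Matrix m n ℝ) :
    IsMoorePenrose M (pinv M) :=
  (exists_isMoorePenrose M).choose_spec

/-- `M^{†/2} = (M†)^{1/2}`; for positive semidefinite `M`, the matrix `M†` is positive
semidefinite (see `pinv_posSemidef`) and `CFC.sqrt` is its positive semidefinite square root. -/
def pinvSqrt {n : Type*} [Fintype n] [DecidableEq n] (M : Matrix n n ℝ) : Matrix n n ℝ :=
  CFC.sqrt (pinv M)

theorem pinv_posSemidef {n : Type*} [Fintype n] {M : Matrix n n ℝ}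
    (hM : M.PosSemidef) : (pinv M).PosSemidef := by
  classical
  have hp := pinv_spec M
  have hMs : Mᵀ = M := by
    rw [← Matrix.conjTranspose_eq_transpose_of_trivial]; exact hM.1
  have hs : (pinv M)ᵀ = pinv M := by
    refine IsMoorePenrose.unique (M := M) ⟨?_, ?_, ?_, ?_⟩ hp
    · have := congrArg Matrix.transpose hp.mul_mul_left
      simpa only [Matrix.transpose_mul, hMs, Matrix.mul_assoc] using this
    · have := congrArg Matrix.transpose hp.mul_mul_right
      simpa only [Matrix.transpose_mul, hMs, Matrix.mul_assoc] using this
    · have := congrArg Matrix.transpose hp.symm_right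
      simpa only [Matrix.transpose_mul, Matrix.transpose_transpose, hMs] using this
    · have := congrArg Matrix.transpose hp.symm_left
      simpa only [Matrix.transpose_mul, Matrix.transpose_transpose, hMs] using this
  have := hM.conjTranspose_mul_mul_same (pinv M)
  rwa [Matrix.conjTranspose_eq_transpose_of_trivial, hs, hp.mul_mul_right] at this

/-- `‖Z‖_{2,1}`: the sum of the Euclidean norms of the rows. -/
def norm21 {N K : ℕ} (Z : Matrix (Fin N) (Fin K) ℝ) : ℝ :=
  ∑ n, ‖WithLp.toLp 2 (Z n)‖

/-- `owℓ_{2,1}(Z) = ‖Z (ZᵀZ)^{†/2}‖_{2,1}`. -/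
def owl21 {N K : ℕ} (Z : Matrix (Fin N) (Fin K) ℝ) : ℝ :=
  norm21 (Z * pinvSqrt (Zᵀ * Z))

/-- `Ψ_γ(Z) = ‖Z (γ I + (1 - γ) ZᵀZ)^{†/2}‖_{2,1}`, meant for `γ ∈ [0, 1]`. -/
def Psi {N K : ℕ} (γ : ℝ) (Z : Matrix (Fin N) (Fin K) ℝ) : ℝ :=
  norm21 (Z * pinvSqrt (γ • (1 : Matrix (Fin K) (Fin K) ℝ) + (1 - γ) • (Zᵀ * Z)))

/-- The family `F` of extended-real functionals Γ-converges to `F₀` along the filter `l` of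
parameters: the liminf inequality and the existence of recovery sequences hold along every
sequence of parameters that tends to `l`. -/
def GammaConverges {ι X : Type*} [TopologicalSpace X] (l : Filter ι)
    (F : ι → X → EReal) (F₀ : X → EReal) : Prop :=
  ∀ γ : ℕ → ι, Tendsto γ atTop l → ∀ x : X,
    (∀ u : ℕ → X, Tendsto u atTop (𝓝 x) →
      F₀ x ≤ liminf (fun k => F (γ k) (u k)) atTop) ∧
    (∃ u : ℕ → X, Tendsto u atTop (𝓝 x) ∧
      limsup (fun k => F (γ k) (u k)) atTop ≤ F₀ x)

end

/-! Each row of `Z M^{†/2}` has squared norm `zᵀM†z`, which for `z` in the range of `M` is the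
maximum over `x` of `2 z·x - xᵀMx`. The pseudo-inverse is discontinuous, but for fixed `x` this
quadratic is continuous in `(M, z)`. Freezing `x` at the maximizer for `(0, Z₀)` therefore gives a
continuous lower bound for `Psi`, exact at `(0, Z₀)` (`psiMinorant_le`, `psiMinorant_self`); this
yields the liminf inequality and lower semicontinuity. For the recovery sequence, `regGram γ Z ≥ (1
- γ) ZᵀZ` bounds `Psi γ Z` by `owl21 Z / √(1 - γ)`, and the two bounds squeeze. -/

/-- The regularized Gram matrix `γ I + (1 - γ) ZᵀZ`. -/
def regGram {N K : ℕ} (γ : ℝ) (Z : Matrix (Fin N) (Fin K) ℝ) : Matrix (Fin K) (Fin K) ℝ :=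
  γ • (1 : Matrix (Fin K) (Fin K) ℝ) + (1 - γ) • (Zᵀ * Z)

theorem Psi_zero {N K : ℕ} (Z : Matrix (Fin N) (Fin K) ℝ) : Psi 0 Z = owl21 Z := by
  simp [Psi, owl21]

theorem regGram_posSemidef {N K : ℕ} {γ : ℝ} (h0 : 0 ≤ γ) (h1 : γ ≤ 1)
    (Z : Matrix (Fin N) (Fin K) ℝ) : (regGram γ Z).PosSemidef := by
  refine (Matrix.PosSemidef.one.smul h0).add (Matrix.PosSemidef.smul ?_ (sub_nonneg.2 h1))
  rw [← Matrix.conjTranspose_eq_transpose_of_trivial]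
  exact Matrix.posSemidef_conjTranspose_mul_self Z

theorem dotProduct_regGram_mulVec {N K : ℕ} (γ : ℝ) (Z : Matrix (Fin N) (Fin K) ℝ)
    (u : Fin K → ℝ) :
    u ⬝ᵥ regGram γ Z *ᵥ u = γ * (u ⬝ᵥ u) + (1 - γ) * (Z *ᵥ u ⬝ᵥ Z *ᵥ u) := by
  rw [regGram, Matrix.add_mulVec, dotProduct_add, Matrix.smul_mulVec, Matrix.smul_mulVec,
    Matrix.one_mulVec, dotProduct_smul, dotProduct_smul, ← Matrix.mulVec_mulVec,
    Matrix.dotProduct_mulVec u Zᵀ, Matrix.vecMul_transpose, smul_eq_mul, smul_eq_mul]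

theorem dotProduct_self_nonneg_real {n : Type*} [Fintype n] (x : n → ℝ) : 0 ≤ x ⬝ᵥ x :=
  Finset.sum_nonneg fun i _ => mul_self_nonneg (x i)

/-- Both terms of the quadratic form are nonnegative, so both vanish. This supplies the kernel
inclusion that puts the rows of `Z` in the range. -/
theorem regGram_mulVec_eq_zero {N K : ℕ} {γ : ℝ} (h0 : 0 ≤ γ) (h1 : γ < 1)
    {Z : Matrix (Fin N) (Fin K) ℝ} {u : Fin K → ℝ} (hu : regGram γ Z *ᵥ u = 0) :
    Z *ᵥ u = 0 := by
  have h := dotProduct_regGram_mulVec γ Z u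
  rw [hu, dotProduct_zero] at h
  have ha : 0 ≤ u ⬝ᵥ u := dotProduct_self_nonneg_real u
  have hb : 0 ≤ Z *ᵥ u ⬝ᵥ Z *ᵥ u := dotProduct_self_nonneg_real _
  have h2 := mul_nonneg h0 ha
  have h3 : (1 - γ) * (Z *ᵥ u ⬝ᵥ Z *ᵥ u) = 0 :=
    le_antisymm (by linarith) (mul_nonneg (by linarith) hb)
  rcases mul_eq_zero.1 h3 with h4 | h4
  · linarith
  · exact dotProduct_self_eq_zero.1 h4

theorem transpose_eq_of_posSemidef {n : Type*} [Fintype n] {M : Matrix n n ℝ}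
    (hM : M.PosSemidef) : Mᵀ = M := by
  rw [← Matrix.conjTranspose_eq_transpose_of_trivial]
  exact hM.1

/-- If `ker M ⊆ ker Z`, then the rows of `Z` lie in the range of the symmetric matrix `M`. -/
theorem mulVec_pinv_mulVec_row {m n : Type*} [Fintype n]
    {M : Matrix n n ℝ} (hM : M.PosSemidef) {Z : Matrix m n ℝ}
    (hker : ∀ u, M *ᵥ u = 0 → Z *ᵥ u = 0) (i : m) :
    M *ᵥ (pinv M *ᵥ Z i) = Z i := by
  have hP := transpose_eq_of_posSemidef (pinv_posSemidef hM)
  have hMt := transpose_eq_of_posSemidef hM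
  ext j
  rw [Matrix.mulVec_mulVec]
  classical
  -- `e_j - M†M e_j` lies in `ker M`, so `Z` kills it; transposing `M†M` then moves the projection
  -- onto the row.
  have h1 : M *ᵥ (Pi.single j 1 - pinv M *ᵥ (M *ᵥ Pi.single j 1)) = 0 := by
    rw [Matrix.mulVec_sub, Matrix.mulVec_mulVec, Matrix.mulVec_mulVec,
      (pinv_spec M).mul_mul_left, sub_self]
  have h2 := congrFun (hker _ h1) i
  rw [Matrix.mulVec_sub, Pi.sub_apply, Pi.zero_apply, sub_eq_zero,
    Matrix.mulVec_single_one] at h2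
  calc ((M * pinv M) *ᵥ Z i) j = ((pinv M * M)ᵀ *ᵥ Z i) j := by
        rw [Matrix.transpose_mul, hP, hMt]
    _ = Z i ⬝ᵥ (pinv M * M) *ᵥ Pi.single j 1 := by
        rw [Matrix.mulVec_single_one, dotProduct_comm]; rfl
    _ = Z i j := by rw [← Matrix.mulVec_mulVec]; exact h2.symm

theorem dotProduct_mulVec_comm_of_posSemidef {n : Type*} [Fintype n] {M : Matrix n n ℝ}
    (hM : M.PosSemidef) (x y : n → ℝ) : x ⬝ᵥ M *ᵥ y = y ⬝ᵥ M *ᵥ x := by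
  rw [Matrix.dotProduct_mulVec, ← Matrix.mulVec_transpose, transpose_eq_of_posSemidef hM,
    dotProduct_comm]

theorem dotProduct_mulVec_self_nonneg {n : Type*} [Fintype n] {M : Matrix n n ℝ}
    (hM : M.PosSemidef) (x : n → ℝ) : 0 ≤ x ⬝ᵥ M *ᵥ x := by
  simpa using hM.dotProduct_mulVec_nonneg x

/-- Young's inequality for the semi-inner product of `M`. -/
theorem two_mul_dotProduct_mulVec_sub_le {n : Type*} [Fintype n] {M : Matrix n n ℝ}
    (hM : M.PosSemidef) {c : ℝ} (hc : 0 < c) (x y : n → ℝ) :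
    2 * (x ⬝ᵥ M *ᵥ y) - c * (x ⬝ᵥ M *ᵥ x) ≤ (y ⬝ᵥ M *ᵥ y) / c := by
  -- Expand the form at `c x - y` and divide by `c`.
  have h := dotProduct_mulVec_self_nonneg hM (c • x - y)
  simp only [Matrix.mulVec_sub, Matrix.mulVec_smul, dotProduct_sub, sub_dotProduct,
    smul_dotProduct, dotProduct_smul, smul_eq_mul,
    dotProduct_mulVec_comm_of_posSemidef hM y x] at h
  rw [le_div_iff₀ hc]
  linarith

/-- The squared norm of a row of `Z M^{†/2}` is the quadratic form of `M†` at the row. -/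
theorem norm_row_mul_pinvSqrt {m n : Type*} [Fintype n] [DecidableEq n]
    {M : Matrix n n ℝ} (hM : M.PosSemidef) (Z : Matrix m n ℝ) (i : m) :
    ‖WithLp.toLp 2 ((Z * pinvSqrt M) i)‖ = √(Z i ⬝ᵥ pinv M *ᵥ Z i) := by
  have h0 : 0 ≤ pinv M := Matrix.nonneg_iff_posSemidef.2 (pinv_posSemidef hM)
  have hS : pinvSqrt M * pinvSqrt M = pinv M := CFC.sqrt_mul_sqrt_self (pinv M) h0
  have hT : (pinvSqrt M)ᵀ = pinvSqrt M :=
    transpose_eq_of_posSemidef (Matrix.nonneg_iff_posSemidef.1 (CFC.sqrt_nonneg (pinv M)))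
  have hrow : (Z * pinvSqrt M) i = pinvSqrt M *ᵥ Z i := by
    rw [Matrix.mul_apply_eq_vecMul, ← Matrix.mulVec_transpose, hT]
  rw [hrow, EuclideanSpace.norm_eq, ← hS, ← Matrix.mulVec_mulVec, Matrix.dotProduct_mulVec,
    ← Matrix.mulVec_transpose, hT]
  simp [dotProduct, sq]

/-- The concave quadratic `x ↦ 2 z·x - xᵀMx`, whose maximum is `zᵀM†z`. -/
def dualQuad {n : Type*} [Fintype n] (M : Matrix n n ℝ) (z x : n → ℝ) : ℝ :=
  2 * (z ⬝ᵥ x) - x ⬝ᵥ M *ᵥ x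

/-- Young's inequality with `c = 1` and `y = M†z`, since `My = z`. -/
theorem dualQuad_le {n : Type*} [Fintype n] {M : Matrix n n ℝ} (hM : M.PosSemidef)
    {z : n → ℝ} (hz : M *ᵥ (pinv M *ᵥ z) = z) (x : n → ℝ) :
    dualQuad M z x ≤ z ⬝ᵥ pinv M *ᵥ z := by
  have h := two_mul_dotProduct_mulVec_sub_le hM one_pos x (pinv M *ᵥ z)
  rw [hz, div_one, one_mul, dotProduct_comm x z, dotProduct_comm _ z] at h
  exact h

theorem dualQuad_pinv_mulVec {n : Type*} [Fintype n] {M : Matrix n n ℝ}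
    {z : n → ℝ} (hz : M *ᵥ (pinv M *ᵥ z) = z) :
    dualQuad M z (pinv M *ᵥ z) = z ⬝ᵥ pinv M *ᵥ z := by
  rw [dualQuad, hz, dotProduct_comm (pinv M *ᵥ z) z]
  ring

theorem Psi_eq_sum_sqrt {N K : ℕ} {γ : ℝ} (h0 : 0 ≤ γ) (h1 : γ ≤ 1)
    (Z : Matrix (Fin N) (Fin K) ℝ) :
    Psi γ Z = ∑ i, √(Z i ⬝ᵥ pinv (regGram γ Z) *ᵥ Z i) := by
  unfold Psi norm21
  exact Finset.sum_congr rfl fun i _ => norm_row_mul_pinvSqrt (regGram_posSemidef h0 h1 Z) Z i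

theorem regGram_mulVec_pinv_mulVec_row {N K : ℕ} {γ : ℝ} (h0 : 0 ≤ γ) (h1 : γ < 1)
    (Z : Matrix (Fin N) (Fin K) ℝ) (i : Fin N) :
    regGram γ Z *ᵥ (pinv (regGram γ Z) *ᵥ Z i) = Z i :=
  mulVec_pinv_mulVec_row (regGram_posSemidef h0 h1.le Z)
    (fun _ hu => regGram_mulVec_eq_zero h0 h1 hu) i

/-- A minorant of `Psi` that is jointly continuous in `γ` and `Z` and exact at `(0, Z₀)`. -/
noncomputable def psiMinorant {N K : ℕ} (Z₀ : Matrix (Fin N) (Fin K) ℝ)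
    (p : ℝ × Matrix (Fin N) (Fin K) ℝ) : ℝ :=
  ∑ i, √(dualQuad (regGram p.1 p.2) (p.2 i) (pinv (regGram 0 Z₀) *ᵥ Z₀ i))

theorem continuous_psiMinorant {N K : ℕ} (Z₀ : Matrix (Fin N) (Fin K) ℝ) :
    Continuous (psiMinorant Z₀) := by
  unfold psiMinorant dualQuad regGram
  -- `dualQuad` may be negative away from `(0, Z₀)`; `Real.sqrt` is then `0` and stays continuous
  -- and monotone on all of `ℝ`.
  refine continuous_finsetSum _ fun i _ => Real.continuous_sqrt.comp ?_
  have hrow : Continuous fun p : ℝ × Matrix (Fin N) (Fin K) ℝ => p.2 i :=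
    (continuous_apply i).comp continuous_snd
  have hM : Continuous fun p : ℝ × Matrix (Fin N) (Fin K) ℝ =>
      p.1 • (1 : Matrix (Fin K) (Fin K) ℝ) + (1 - p.1) • (p.2ᵀ * p.2) :=
    (continuous_fst.smul continuous_const).add
      ((continuous_const.sub continuous_fst).smul
        (continuous_snd.matrix_transpose.matrix_mul continuous_snd))
  exact (continuous_const.mul (hrow.dotProduct continuous_const)).sub
    (continuous_const.dotProduct (hM.matrix_mulVec continuous_const))

theorem psiMinorant_self {N K : ℕ} (Z₀ : Matrix (Fin N) (Fin K) ℝ) :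
    psiMinorant Z₀ (0, Z₀) = owl21 Z₀ := by
  rw [← Psi_zero, Psi_eq_sum_sqrt le_rfl zero_le_one]
  refine Finset.sum_congr rfl fun i _ => ?_
  rw [dualQuad_pinv_mulVec (regGram_mulVec_pinv_mulVec_row le_rfl one_pos Z₀ i)]

theorem psiMinorant_le {N K : ℕ} {γ : ℝ} (h0 : 0 ≤ γ) (h1 : γ < 1)
    (Z₀ Z : Matrix (Fin N) (Fin K) ℝ) : psiMinorant Z₀ (γ, Z) ≤ Psi γ Z := by
  rw [Psi_eq_sum_sqrt h0 h1.le]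
  exact Finset.sum_le_sum fun i _ => Real.sqrt_le_sqrt
    (dualQuad_le (regGram_posSemidef h0 h1.le Z) (regGram_mulVec_pinv_mulVec_row h0 h1 Z i) _)

theorem Psi_le_owl21_div_sqrt {N K : ℕ} {γ : ℝ} (h0 : 0 ≤ γ) (h1 : γ < 1)
    (Z : Matrix (Fin N) (Fin K) ℝ) : Psi γ Z ≤ owl21 Z / √(1 - γ) := by
  rw [← Psi_zero, Psi_eq_sum_sqrt h0 h1.le, Psi_eq_sum_sqrt le_rfl zero_le_one, Finset.sum_div]
  refine Finset.sum_le_sum fun i _ => ?_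
  have hg : 0 < 1 - γ := sub_pos.2 h1
  rw [← Real.sqrt_div' _ hg.le]
  refine Real.sqrt_le_sqrt ?_
  have hz := regGram_mulVec_pinv_mulVec_row h0 h1 Z i
  have hz0 := regGram_mulVec_pinv_mulVec_row le_rfl one_pos Z i
  rw [← dualQuad_pinv_mulVec hz, dualQuad, dotProduct_regGram_mulVec]
  set y := pinv (regGram γ Z) *ᵥ Z i
  -- Taking `c = 1 - γ` matches the coefficient of `|Zy|²` at the maximizer `y`; the remaining
  -- `-γ|y|²` is dropped.
  have h := two_mul_dotProduct_mulVec_sub_le (regGram_posSemidef le_rfl zero_le_one Z) hg y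
    (pinv (regGram 0 Z) *ᵥ Z i)
  rw [hz0, dotProduct_regGram_mulVec, dotProduct_comm y, dotProduct_comm _ (Z i)] at h
  have hy : 0 ≤ γ * (y ⬝ᵥ y) := mul_nonneg h0 (dotProduct_self_nonneg_real y)
  linarith

theorem tendsto_psiMinorant {N K : ℕ} {α : Type*} {l : Filter α} {γ : α → ℝ}
    {u : α → Matrix (Fin N) (Fin K) ℝ} {Z : Matrix (Fin N) (Fin K) ℝ}
    (hγ : Tendsto γ l (𝓝 0)) (hu : Tendsto u l (𝓝 Z)) :
    Tendsto (fun k => psiMinorant Z (γ k, u k)) l (𝓝 (owl21 Z)) := by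
  rw [← psiMinorant_self Z]
  exact ((continuous_psiMinorant Z).tendsto (0, Z)).comp (hγ.prodMk_nhds hu)

theorem eventually_nonneg_and_lt_one {α : Type*} {l : Filter α} {γ : α → ℝ}
    (hγ : Tendsto γ l (𝓝[Icc (0 : ℝ) 1] 0)) : ∀ᶠ k in l, 0 ≤ γ k ∧ γ k < 1 := by
  obtain ⟨h, hm⟩ := tendsto_nhdsWithin_iff.1 hγ
  filter_upwards [hm, h.eventually (gt_mem_nhds one_pos)] with k hk hk1
  exact ⟨hk.1, hk1⟩

theorem tendsto_Psi {N K : ℕ} {α : Type*} {l : Filter α} {γ : α → ℝ}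
    (hγ : Tendsto γ l (𝓝[Icc (0 : ℝ) 1] 0)) (Z : Matrix (Fin N) (Fin K) ℝ) :
    Tendsto (fun k => Psi (γ k) Z) l (𝓝 (owl21 Z)) := by
  have h := (tendsto_nhdsWithin_iff.1 hγ).1
  have hev := eventually_nonneg_and_lt_one hγ
  have hup : Tendsto (fun k => owl21 Z / √(1 - γ k)) l (𝓝 (owl21 Z)) := by
    have hs : Tendsto (fun k => √(1 - γ k)) l (𝓝 1) := by
      simpa [Function.comp_def] using (Real.continuous_sqrt.tendsto _).comp (tendsto_const_nhds (x := (1 : ℝ)).sub h)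
    simpa [Pi.div_def] using (tendsto_const_nhds (x := owl21 Z)).div hs one_ne_zero
  refine tendsto_of_tendsto_of_tendsto_of_le_of_le'
    (tendsto_psiMinorant h (tendsto_const_nhds (x := Z))) hup ?_ ?_
  · exact hev.mono fun k hk => psiMinorant_le hk.1 hk.2 Z Z
  · exact hev.mono fun k hk => Psi_le_owl21_div_sqrt hk.1 hk.2 Z

theorem tendsto_coe_Psi {N K : ℕ} {γ : ℕ → ℝ}
    (hγ : Tendsto γ atTop (𝓝[Icc (0 : ℝ) 1] 0)) (Z : Matrix (Fin N) (Fin K) ℝ) :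
    Tendsto (fun k => ((Psi (γ k) Z : ℝ) : EReal)) atTop (𝓝 ((owl21 Z : ℝ) : EReal)) :=
  EReal.tendsto_coe.2 (tendsto_Psi hγ Z)

theorem owl21_le_liminf_Psi {N K : ℕ} {γ : ℕ → ℝ}
    (hγ : Tendsto γ atTop (𝓝[Icc (0 : ℝ) 1] 0)) {u : ℕ → Matrix (Fin N) (Fin K) ℝ}
    {Z : Matrix (Fin N) (Fin K) ℝ} (hu : Tendsto u atTop (𝓝 Z)) :
    ((owl21 Z : ℝ) : EReal) ≤ liminf (fun k => ((Psi (γ k) (u k) : ℝ) : EReal)) atTop := by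
  have h := EReal.tendsto_coe.2 (tendsto_psiMinorant (tendsto_nhdsWithin_iff.1 hγ).1 hu)
  rw [← h.liminf_eq]
  exact liminf_le_liminf ((eventually_nonneg_and_lt_one hγ).mono fun k hk =>
    EReal.coe_le_coe_iff.2 (psiMinorant_le hk.1 hk.2 Z (u k)))

/-- The minorant anchored at `Z`, restricted to `γ = 0`, is continuous, lies below `owl21` and
touches it at `Z`. -/
theorem lowerSemicontinuous_owl21 (N K : ℕ) :
    LowerSemicontinuous (fun Z : Matrix (Fin N) (Fin K) ℝ => owl21 Z) := by
  intro Z y hy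
  have h := tendsto_psiMinorant (tendsto_const_nhds (x := (0 : ℝ))) (tendsto_id (x := 𝓝 Z))
  filter_upwards [h.eventually (lt_mem_nhds hy)] with W hW
  exact hW.trans_le ((psiMinorant_le le_rfl one_pos Z W).trans_eq (Psi_zero W))

theorem mainTheorem6 (N K : ℕ) :
    -- Γ-convergence as `γ → 0` in `[0, 1]`
    GammaConverges (𝓝[Icc (0 : ℝ) 1] 0)
      (fun γ (Z : Matrix (Fin N) (Fin K) ℝ) => ((Psi γ Z : ℝ) : EReal))
      (fun Z => ((owl21 Z : ℝ) : EReal)) ∧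
    -- the constant sequence is a recovery sequence, with convergence of the values
    (∀ γ : ℕ → ℝ, Tendsto γ atTop (𝓝[Icc (0 : ℝ) 1] 0) →
      ∀ Z : Matrix (Fin N) (Fin K) ℝ,
        limsup (fun k => ((Psi (γ k) Z : ℝ) : EReal)) atTop ≤ ((owl21 Z : ℝ) : EReal) ∧
        Tendsto (fun k => Psi (γ k) Z) atTop (𝓝 (owl21 Z))) ∧
    LowerSemicontinuous (fun Z : Matrix (Fin N) (Fin K) ℝ => owl21 Z) := by
  refine ⟨fun γ hγ Z => ⟨fun u hu => owl21_le_liminf_Psi hγ hu, fun _ => Z,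
    tendsto_const_nhds, (tendsto_coe_Psi hγ Z).limsup_eq.le⟩, fun γ hγ Z =>
    ⟨(tendsto_coe_Psi hγ Z).limsup_eq.le, tendsto_Psi hγ Z⟩, lowerSemicontinuous_owl21 N K⟩
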